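/- Let $k\ge 1$, $t\ge 0$ and $n\ge 1$ be integers, and let $a_0,a_1,\dots,a_t$ and $x$ be elements of a commutative ring with unity (in particular $x$ may be an indeterminate). Let $J_k$ be the $k\times k$ matrix of ones, $\otimes$ the Kronecker product, $\operatorname{per}$ the permanent, and let $P_n(x)$ be the $n\times n$ matrix whose $(i,j)$ entry is $1$ if $j-i=1$, is $x$ if $j-i\ne 1$ and $j-i\equiv 1\pmod n$, and is $0$ otherwise (so $P_1(x)=(x)$). For $0\le r\le kt$ let $$G_{r,t}^{[k]}=\Bigl\{(1^{\langle l_1\rangle},2^{\langle l_2\rangle},\dots,t^{\langle l_t\rangle}) \;\Big|\; 0\le l_i\le k\ (1\le i\le t),\ \sum_{i=1}^t l_i=r\Bigr\},$$ where $i^{\langle l\rangle}$ denotes $i$ repeated $l$ times. Let $\Pi_{r,t}^{[k]}(a_0,\dots,a_t)=(a_{\alpha,\beta})_{\alpha,\beta\in G_{r,t}^{[k]}}$ be the following square matrix. If $t=0$ (so $r=0$), it is the $1\times 1$ matrix $(k!\,a_0^k)$. If $t\ge 1$ and $\alpha=(1^{\langle l_1\rangle},\dots,t^{\langle l_t\rangle})$,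 then $$a_{\alpha,\beta}=k!\binom{k}{l_t+\sum_{i=1}^{t-1}p_i}\binom{l_1}{p_1}\cdots\binom{l_{t-1}}{p_{t-1}}\;a_0^{\,k-l_t-\sum_{i=1}^{t-1}p_i}\,a_1^{p_1}\cdots a_{t-1}^{p_{t-1}}\,a_t^{l_t}$$ if $\beta=\bigl(1^{\langle l_t+\sum_{i=1}^{t-1}p_i\rangle},2^{\langle l_1-p_1\rangle},\dots,t^{\langle l_{t-1}-p_{t-1}\rangle}\bigr)$ for some (necessarily unique) integers $0\le p_i\le l_i$ $(1\le i\le t-1)$ with $\sum_{i=1}^{t-1}p_i\le k-l_t$, and $a_{\alpha,\beta}=0$ otherwise. Then $$\operatorname{per}\Bigl(\Bigl(\sum_{i=0}^t a_i\,(P_n(x))^i\Bigr)\otimes J_k\Bigr)=\sum_{r=0}^{kt}\operatorname{Tr}\Bigl(\bigl(\Pi_{r,t}^{[k]}(a_0,\dots,a_t)\bigr)^n\Bigr)\,x^r .$$ -/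

import Mathlib

open scoped Nat

/-- The set `G_{r,t}^{[k]}` of weakly increasing vectors `(1^{⟨l₁⟩}, …, t^{⟨l_t⟩})` with
`0 ≤ l_i ≤ k` and `l₁ + ⋯ + l_t = r`.  Such a vector is recorded by its multiplicities
`(l₁, …, l_t)`, the multiplicity `l_{i+1}` being the value of the function at `i : Fin t`. -/
abbrev MultVec (k r t : ℕ) : Type :=
  {l : Fin t → Fin (k + 1) // ∑ i, (l i : ℕ) = r}

namespace MultVec

/-- The multiplicity of the component `i + 1` in the vector. -/
def mult {k r t : ℕ} (α : MultVec k r t) (i : Fin t) : ℕ := (α.1 i : ℕ)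

end MultVec

/-- The matrix `Π_{r,t}^{[k]}(a₀, …, a_t)` on the set `G_{r,t}^{[k]}`.

For `t = 0` it is the scalar `k! a₀^k` (on the one-point set `G_{0,0}^{[k]}`).

For `t = s + 1 ≥ 1`, let `α = (1^{⟨l₁⟩}, …, t^{⟨l_t⟩})`.  The entry at `(α, β)` is nonzero only if
`β = (1^{⟨l_t + p₁ + ⋯ + p_{t-1}⟩}, 2^{⟨l₁ - p₁⟩}, …, t^{⟨l_{t-1} - p_{t-1}⟩})` for some
`0 ≤ p_i ≤ l_i`.  Those `p_i` are determined by `α` and `β`: `p_i = l_i - m_β(i + 1)`, subject to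
`m_β(i + 1) ≤ l_i`, and the remaining condition is `m_β(1) = l_t + p₁ + ⋯ + p_{t-1}` (which gives
`p₁ + ⋯ + p_{t-1} ≤ k - l_t` because `m_β(1) ≤ k`).  The index `i : Fin s` stands for
the index `i + 1` of the `p`'s. -/
def PiMatrix {R : Type*} [CommRing R] (k r : ℕ) :
    (t : ℕ) → (Fin (t + 1) → R) → Matrix (MultVec k r t) (MultVec k r t) R
  | 0, a => Matrix.of fun _ _ => (k ! : R) * a 0 ^ k
  | s + 1, a => Matrix.of fun α β =>
      let p : Fin s → ℕ := fun i => α.mult i.castSucc - β.mult i.succ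
      let lt : ℕ := α.mult (Fin.last s)
      if (∀ i : Fin s, β.mult i.succ ≤ α.mult i.castSucc) ∧ β.mult 0 = lt + ∑ i, p i then
        (k ! : R) * (k.choose (lt + ∑ i, p i) : R) *
          (∏ i : Fin s, ((α.mult i.castSucc).choose (p i) : R)) *
          a 0 ^ (k - lt - ∑ i, p i) *
          (∏ i : Fin s, a i.succ.castSucc ^ p i) *
          a (Fin.last (s + 1)) ^ lt
      else 0

/-- The `n × n` matrix `P_n(x)`: the entry at `(i, j)` is `1` if `j - i = 1`, it is `x` if
`j - i ≠ 1` and `j - i ≡ 1 (mod n)`, and it is `0` otherwise. -/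
def shiftMatrix {R : Type*} [CommRing R] (n : ℕ) (x : R) : Matrix (Fin n) (Fin n) R :=
  Matrix.of fun i j =>
    if (j : ℤ) - (i : ℤ) = 1 then 1
    else if (j : ℤ) - (i : ℤ) ≡ 1 [ZMOD (n : ℤ)] then x
    else 0

/-- The `k × k` matrix `J_k` of ones. -/
def onesMatrix (R : Type*) [CommRing R] (k : ℕ) : Matrix (Fin k) (Fin k) R :=
  Matrix.of fun _ _ => 1

/-! Up to the factor `(k !)^n`, the permanent is the coefficient of `∏ j, X j ^ k` in the product of
the `k`-th powers of the row forms (`permanent_kronecker_ones_eq_coeff`). Each row `i` thus launches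
`k` particles round a cycle; one that moves `s` steps has weight `a s` and lands in column `i + s`,
every column must receive exactly `k`, and each crossing of the seam into `0` costs a factor `x`.
`pow_sum_mul_prod` records row `i` by the numbers `H i s` of particles moving more than `s` steps.
The shear `p j s = H (j - (s + 1)) s` instead records, by age, the particles that reach column `j`
from earlier rows. The landing condition at `j` then involves only `p j` and `p (j + 1)`, so the sum
runs over closed walks of `transferMatrix`, and the exponent of `x` is the total of the state at
`0`. Since `k` particles start and `k` stop at each column, that total is conserved; the blocks of
the transfer matrix on its level sets are the `PiMatrix k r t a`. -/

/-! ### Permanents of Kronecker products with a matrix of ones. -/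

/-- The permutations carrying one labelling to another with the same fibre sizes are
counted by the product of the factorials of the fibre sizes. -/
theorem card_perm_comp_eq {α ι : Type*} [Fintype α] [DecidableEq α] [Fintype ι] [DecidableEq ι]
    (p f : α → ι) (h : ∀ i, Fintype.card {a // f a = i} = Fintype.card {a // p a = i}) :
    Fintype.card {σ : Equiv.Perm α // p ∘ σ = f} = ∏ i, (Fintype.card {a // p a = i})! := by
  have e : ∀ i, {a // f a = i} ≃ {a // p a = i} := fun i => Fintype.equivOfCardEq (h i)
  let τ : Equiv.Perm α := Equiv.ofFiberEquiv e
  have hτ : ∀ a, p (τ a) = f a := fun a => Equiv.ofFiberEquiv_map e a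
  rw [← DomMulAct.stabilizer_card p]
  -- As `f = p ∘ τ`, the permutations sought form the coset (stabilizer of `p`) `* τ`.
  refine Fintype.card_congr ((Equiv.mulRight τ⁻¹).subtypeEquiv fun σ => ?_)
  constructor
  · rintro h
    funext a
    have := congrFun h (τ.symm a)
    simp only [Function.comp_apply] at this
    rw [← hτ, τ.apply_symm_apply] at this
    simpa using this
  · rintro h
    funext a
    have := congrFun h (τ a)
    simpa [hτ] using this

/-- The permanent of a matrix tensored with a matrix of ones, as a sum over the functions all of
whose fibres have size `k`. -/
theorem permanent_kronecker_ones {R ι : Type*} [CommRing R] [Fintype ι] [DecidableEq ι] (k : ℕ)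
    (M : Matrix ι ι R) :
    (Matrix.kroneckerMap (fun u v : R => u * v) M (onesMatrix R k)).permanent
      = ∑ f : ι × Fin k → ι, if ∀ j, Fintype.card {a // f a = j} = k then
          (k ! : R) ^ Fintype.card ι * ∏ a : ι × Fin k, M a.1 (f a) else 0 := by
  have hp : ∀ i : ι, Fintype.card {a : ι × Fin k // a.1 = i} = k := fun i => by
    rw [Fintype.card_congr (Equiv.prodSubtypeFstEquivSubtypeProd (p := fun j => j = i))]
    simp
  rw [← Matrix.permanent_transpose]
  have h1 : (Matrix.kroneckerMap (fun u v : R => u * v) M (onesMatrix R k)).transpose.permanent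
      = ∑ σ : Equiv.Perm (ι × Fin k), ∏ a : ι × Fin k, M a.1 ((Prod.fst ∘ σ) a) := by
    simp [Matrix.permanent, onesMatrix]
  rw [h1, ← Finset.sum_fiberwise Finset.univ
    (fun σ : Equiv.Perm (ι × Fin k) => (Prod.fst ∘ σ : ι × Fin k → ι))]
  refine Finset.sum_congr rfl fun f _ => ?_
  rw [Finset.sum_congr rfl (g := fun _ => ∏ a : ι × Fin k, M a.1 (f a))
    (fun σ hσ => by rw [(Finset.mem_filter.1 hσ).2]), Finset.sum_const, nsmul_eq_mul]
  split_ifs with h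
  · congr 1
    rw [← Fintype.card_subtype, card_perm_comp_eq _ f fun i => by rw [h, hp]]
    simp [hp]
  · rw [Finset.card_eq_zero.2, Nat.cast_zero, zero_mul]
    refine Finset.filter_eq_empty_iff.2 fun σ _ hσ => h fun j => ?_
    refine Eq.trans ?_ (hp j)
    refine Fintype.card_congr (σ.subtypeEquiv fun a => ?_)
    rw [← hσ]; rfl

open MvPolynomial in
/-- The same permanent as a coefficient of a product of linear forms. -/
theorem permanent_kronecker_ones_eq_coeff {R ι : Type*} [CommRing R] [Fintype ι] [DecidableEq ι]
    (k : ℕ) (M : Matrix ι ι R) :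
    (Matrix.kroneckerMap (fun u v : R => u * v) M (onesMatrix R k)).permanent
      = (k ! : R) ^ Fintype.card ι *
        coeff (Finsupp.equivFunOnFinite.symm fun _ => k)
          (∏ i, (∑ j, C (M i j) * X j : MvPolynomial ι R) ^ k) := by
  have h1 : (∏ i, (∑ j, C (M i j) * X j : MvPolynomial ι R) ^ k)
      = ∏ a : ι × Fin k, ∑ j, C (M a.1 j) * X j := by
    simp [Fintype.prod_prod_type]
  rw [permanent_kronecker_ones, h1, Fintype.prod_sum, coeff_sum, Finset.mul_sum]
  refine Finset.sum_congr rfl fun f _ => ?_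
  have h2 : (∏ a, (X (f a) : MvPolynomial ι R)) = ∏ j, X j ^ Fintype.card {a // f a = j} := by
    rw [← Finset.prod_fiberwise Finset.univ f]
    refine Finset.prod_congr rfl fun j _ => ?_
    rw [Finset.prod_congr rfl (g := fun _ => (X j : MvPolynomial ι R))
      (fun a ha => by rw [(Finset.mem_filter.1 ha).2]), Finset.prod_const, Fintype.card_subtype]
  have h3 : (∏ j, (X j : MvPolynomial ι R) ^ Fintype.card {a // f a = j})
      = monomial (Finsupp.equivFunOnFinite.symm fun j => Fintype.card {a // f a = j}) 1 := by
    rw [monomial_eq, Finsupp.prod_fintype _ _ (by simp)]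
    simp
  rw [Finset.prod_mul_distrib, ← map_prod, coeff_C_mul, h2, h3, coeff_monomial]
  simp only [EmbeddingLike.apply_eq_iff_eq, funext_iff]
  split_ifs <;> simp

/-! ### Multinomial and closed-walk expansions. -/

/-- The multinomial theorem in telescoping form, for a sum written in Horner style. -/
theorem pow_sum_mul_prod {A : Type*} [CommRing A] (K : ℕ) (t : ℕ) : ∀ (b : Fin (t + 1) → A)
    (w : ℕ → A) (e : ℕ), e ≤ K →
    (∑ s : Fin (t + 1), b s * ∏ u ∈ Finset.range s, w u) ^ e
      = ∑ h : Fin t → Fin (K + 1),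
        let H : Fin (t + 1) → ℕ := Fin.cons e fun s => (h s : ℕ)
        (∏ s : Fin t, ((H s.castSucc).choose (H s.succ) : A)) *
        ((∏ s : Fin t, b s.castSucc ^ (H s.castSucc - H s.succ)) *
          b (Fin.last t) ^ H (Fin.last t)) * ∏ s : Fin t, w s ^ (h s : ℕ) := by
  induction t with
  | zero => intro b w e _; simp
  | succ t ih =>
    intro b w e he
    have h0 : (∑ s : Fin (t + 2), b s * ∏ u ∈ Finset.range s, w u)
        = w 0 * (∑ s : Fin (t + 1), b s.succ * ∏ u ∈ Finset.range s, w (u + 1)) + b 0 := by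
      rw [Fin.sum_univ_succ, add_comm, Finset.mul_sum]
      simp only [Fin.val_zero, Finset.range_zero, Finset.prod_empty, mul_one, Fin.val_succ]
      congr 1
      refine Finset.sum_congr rfl fun s _ => ?_
      rw [Finset.prod_range_succ']
      ring
    -- The uniform bound `K` gives all levels the same index type; the added terms have a zero
    -- binomial.
    have h1 : ∀ F : ℕ → A, ∑ m ∈ Finset.range (e + 1), F m * (e.choose m : A)
        = ∑ m : Fin (K + 1), F m * (e.choose m : A) := fun F => by
      rw [Fin.sum_univ_eq_sum_range (fun m => F m * (e.choose m : A))]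
      refine Finset.sum_subset (Finset.range_subset_range.2 (by omega)) fun m _ hm => ?_
      rw [Nat.choose_eq_zero_of_lt (by simpa using hm)]
      simp
    rw [h0, add_pow, h1, ← (Fin.consEquiv fun _ : Fin (t + 1) => Fin (K + 1)).sum_comp,
      Fintype.sum_prod_type]
    refine Finset.sum_congr rfl fun m _ => ?_
    rw [mul_pow, ih (fun s => b s.succ) (fun u => w (u + 1)) m (by omega),
      Finset.mul_sum, Finset.sum_mul, Finset.sum_mul]
    refine Finset.sum_congr rfl fun h _ => ?_
    have hH : (fun s => ((Fin.cons m h : Fin (t + 1) → Fin (K + 1)) s : ℕ))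
        = Fin.cons (m : ℕ) (fun s => (h s : ℕ)) := by
      funext s
      refine Fin.cases ?_ (fun s => ?_) s <;> simp
    simp only [Fin.consEquiv_apply, hH]
    rw [Fin.prod_univ_succ, Fin.prod_univ_succ, Fin.prod_univ_succ]
    simp only [Fin.castSucc_zero, Fin.cons_zero, Fin.cons_succ, Fin.castSucc_succ, Fin.val_zero,
      Fin.val_succ, ← Fin.succ_last]
    ring

/-- A closed-walk expansion of a weighted trace of a matrix power. -/
theorem sum_pow_diag_mul {S R : Type*} [Fintype S] [DecidableEq S] [CommRing R]
    (W : Matrix S S R) (D : S → R) (m : ℕ) :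
    ∑ α, (W ^ (m + 1)) α α * D α
      = ∑ p : Fin (m + 1) → S, (∏ i, W (p i) (p (i + 1))) * D (p 0) := by
  have key : ∀ (m : ℕ) (α β : S), (W ^ (m + 1)) α β = ∑ p : Fin (m + 1) → S,
      if p 0 = α then (∏ i : Fin m, W (p i.castSucc) (p i.succ)) * W (p (Fin.last m)) β
        else 0 := by
    intro m
    induction m with
    | zero =>
      intro α β
      rw [← (Equiv.funUnique (Fin 1) S).symm.sum_comp]
      simp
    | succ m ih =>
      intro α β
      rw [pow_succ', Matrix.mul_apply, ← (Fin.consEquiv fun _ : Fin (m + 2) => S).sum_comp,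
        Fintype.sum_prod_type]
      simp only [Fin.consEquiv_apply, Fin.cons_zero, ih]
      symm
      rw [Finset.sum_eq_single α (by intro b _ hb; simp [hb]) (by simp)]
      simp only [Finset.mul_sum]
      rw [Finset.sum_comm]
      refine Finset.sum_congr rfl fun p _ => ?_
      rw [Finset.sum_eq_single (p 0) (by intro b _ hb; simp [hb.symm]) (by simp),
        Fin.prod_univ_succ, ← Fin.succ_last]
      simp [mul_assoc]
  simp only [key, Finset.sum_mul]
  rw [Finset.sum_comm]
  refine Finset.sum_congr rfl fun p _ => ?_
  rw [Finset.sum_eq_single (p 0) (by intro b _ hb; simp [hb.symm]) (by simp),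
    Fin.prod_univ_castSucc]
  simp

/-! ### The transfer matrix and its blocks. -/

/-- The matrix `Π_{r,t}^{[k]}` for all `r` at once, in a form uniform in `t`: `k` is put in front
of the multiplicities of the row index. -/
def transferMatrix {R : Type*} [CommRing R] (k t : ℕ) (a : Fin (t + 1) → R) :
    Matrix (Fin t → Fin (k + 1)) (Fin t → Fin (k + 1)) R :=
  Matrix.of fun α β =>
    let A : Fin (t + 1) → ℕ := Fin.cons k fun s => (α s : ℕ)
    if ∑ s : Fin t, (A s.castSucc - β s) + A (Fin.last t) = k then
      (k ! : R) * ((∏ s : Fin t, ((A s.castSucc).choose (β s) : R)) *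
        ((∏ s : Fin t, a s.castSucc ^ (A s.castSucc - (β s : ℕ))) *
          a (Fin.last t) ^ A (Fin.last t)))
    else 0

theorem PiMatrix_apply_eq_transferMatrix {R : Type*} [CommRing R] (k r t : ℕ)
    (a : Fin (t + 1) → R) (α β : MultVec k r t) :
    PiMatrix k r t a α β = transferMatrix k t a α.1 β.1 := by
  cases t with
  | zero => simp [PiMatrix, transferMatrix]
  | succ s =>
    have hβ : (β.1 0 : ℕ) ≤ k := by omega
    simp only [PiMatrix, transferMatrix, Matrix.of_apply, MultVec.mult]
    rw [Fin.sum_univ_succ, Fin.prod_univ_succ, Fin.prod_univ_succ]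
    simp only [Fin.castSucc_zero, Fin.cons_zero, Fin.castSucc_succ, Fin.cons_succ,
      ← Fin.succ_last]
    by_cases h : ∀ i : Fin s, (β.1 i.succ : ℕ) ≤ α.1 i.castSucc
    · simp only [h, implies_true, true_and]
      by_cases h2 : (β.1 0 : ℕ)
          = α.1 (Fin.last s) + ∑ i : Fin s, ((α.1 i.castSucc : ℕ) - β.1 i.succ)
      -- The term `s = 0` of the transfer matrix supplies `k.choose (β 0)` and `a 0 ^ (k - β 0)`;
      -- the other binomials agree by symmetry.
      · rw [if_pos h2, if_pos (by omega), Nat.sub_sub, ← h2]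
        simp only [Nat.choose_symm (h _)]
        ring
      · rw [if_neg h2, if_neg (by omega)]
    · rw [if_neg (fun h' => h h'.1)]
      push Not at h
      obtain ⟨i, hi⟩ := h
      rw [Finset.prod_eq_zero (Finset.mem_univ i)
        (by rw [Nat.choose_eq_zero_of_lt hi, Nat.cast_zero])]
      simp

/-- Conservation of the number of particles in flight: `k` join and `k` stop. Nonzero binomials make
the truncated subtractions genuine, so the sum can be split. -/
theorem sum_eq_of_transferMatrix_ne_zero {R : Type*} [CommRing R] {k t : ℕ}
    {a : Fin (t + 1) → R} {α β : Fin t → Fin (k + 1)} (h : transferMatrix k t a α β ≠ 0) :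
    ∑ i, (α i : ℕ) = ∑ i, (β i : ℕ) := by
  simp only [transferMatrix, Matrix.of_apply] at h
  set A : Fin (t + 1) → ℕ := Fin.cons k fun s => (α s : ℕ) with hA
  have h1 : ∑ s : Fin t, (A s.castSucc - β s) + A (Fin.last t) = k := by
    by_contra h1
    exact h (if_neg h1)
  have h2 : ∀ s : Fin t, (β s : ℕ) ≤ A s.castSucc := fun s => by
    by_contra h2
    apply h
    rw [Finset.prod_eq_zero (Finset.mem_univ s)
      (by rw [Nat.choose_eq_zero_of_lt (not_le.1 h2), Nat.cast_zero])]
    simp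
  have h3 : ∑ s : Fin t, A s.castSucc + A (Fin.last t) = k + ∑ i, (α i : ℕ) := by
    rw [← Fin.sum_univ_castSucc, Fin.sum_univ_succ]
    simp [hA]
  have h4 : ∑ s : Fin t, (A s.castSucc - β s) + ∑ s, (β s : ℕ) = ∑ s : Fin t, A s.castSucc := by
    rw [← Finset.sum_add_distrib]
    exact Finset.sum_congr rfl fun s _ => Nat.sub_add_cancel (h2 s)
  omega

theorem PiMatrix_pow_apply {R : Type*} [CommRing R] (k r t : ℕ) (a : Fin (t + 1) → R) (n : ℕ) :
    ∀ α β : MultVec k r t, (PiMatrix k r t a ^ n) α β = (transferMatrix k t a ^ n) α.1 β.1 := by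
  induction n with
  | zero => intro α β; simp [Matrix.one_apply, Subtype.ext_iff]
  | succ n ih =>
    intro α β
    rw [pow_succ, pow_succ, Matrix.mul_apply, Matrix.mul_apply]
    rw [← Finset.sum_subset (Finset.filter_subset
      (fun l : Fin t → Fin (k + 1) => ∑ i, (l i : ℕ) = r) Finset.univ)]
    · rw [Finset.sum_subtype (p := fun l : Fin t → Fin (k + 1) => ∑ i, (l i : ℕ) = r) _ (by simp)]
      exact Finset.sum_congr rfl fun γ _ => by rw [ih, PiMatrix_apply_eq_transferMatrix]
    -- Intermediate states off the level `r` contribute nothing, by conservation.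
    · intro γ _ hγ
      have : transferMatrix k t a γ β.1 = 0 := by
        by_contra h
        exact hγ (by simpa [β.2] using sum_eq_of_transferMatrix_ne_zero h)
      rw [this, mul_zero]

/-- The generating function of the traces is a weighted trace of the transfer matrix. -/
theorem sum_trace_PiMatrix_pow {R : Type*} [CommRing R] (k t n : ℕ) (a : Fin (t + 1) → R)
    (x : R) :
    ∑ r ∈ Finset.range (k * t + 1), (PiMatrix k r t a ^ n).trace * x ^ r
      = ∑ α, (transferMatrix k t a ^ n) α α * x ^ ∑ i, (α i : ℕ) := by
  rw [← Finset.sum_fiberwise_of_maps_to (t := Finset.range (k * t + 1))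
    (g := fun α : Fin t → Fin (k + 1) => ∑ i, (α i : ℕ))]
  · refine Finset.sum_congr rfl fun r _ => ?_
    rw [Finset.sum_subtype (p := fun l : Fin t → Fin (k + 1) => ∑ i, (l i : ℕ) = r) _ (by simp),
      Matrix.trace, Finset.sum_mul]
    exact Finset.sum_congr rfl fun γ _ => by
      rw [Matrix.diag_apply, PiMatrix_pow_apply, γ.2]
  · intro α _
    have : ∑ i, (α i : ℕ) ≤ ∑ _i : Fin t, k := Finset.sum_le_sum fun i _ => by omega
    simp only [Finset.sum_const, Finset.card_univ, Fintype.card_fin, smul_eq_mul] at this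
    rw [Finset.mem_range]
    linarith

/-! ### Powers of the weighted cyclic shift. -/

theorem shiftMatrix_succ_apply {R : Type*} [CommRing R] (m : ℕ) (x : R) (i j : Fin (m + 1)) :
    shiftMatrix (m + 1) x i j = if j = i + 1 then (if i + 1 = 0 then x else 1) else 0 := by
  simp only [shiftMatrix, Matrix.of_apply]
  have hj := j.2
  by_cases hi : i = Fin.last m
  · subst hi
    -- In the last row `j - i = 1` is impossible, so only the wrapping entry survives.
    rw [Fin.last_add_one, if_neg (by simp only [Fin.val_last]; omega), if_pos rfl]
    refine if_congr ?_ rfl rfl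
    rw [Int.modEq_iff_dvd, Fin.ext_iff, Fin.val_zero, Fin.val_last]
    constructor
    · rintro ⟨c, hc⟩
      have h1 : (j : ℤ) = (m + 1) * (1 - c) := by push_cast at hc; linarith
      by_contra h0
      have h2 : ((m + 1 : ℕ) : ℤ) ∣ (j : ℕ) := ⟨1 - c, by push_cast; exact h1⟩
      have := Nat.le_of_dvd (by omega) (Int.natCast_dvd_natCast.1 h2)
      omega
    · intro h
      exact ⟨1, by rw [h]; push_cast; ring⟩
  · have hv : ((i + 1 : Fin (m + 1)) : ℕ) = i + 1 := by rw [Fin.val_add_one, if_neg hi]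
    have h0 : i + 1 ≠ 0 := fun h => by rw [h] at hv; simp at hv
    have hi' : (i : ℕ) + 1 < m + 1 := hv ▸ (i + 1).2
    rw [if_neg h0]
    by_cases h : j = i + 1
    · rw [if_pos h, if_pos]
      rw [h, hv]; push_cast; ring
    · have h' : (j : ℕ) ≠ i + 1 := fun h' => h (Fin.ext (h'.trans hv.symm))
      rw [if_neg h, if_neg (by omega), if_neg]
      intro hmod
      have h1 := Int.modEq_iff_dvd.1 hmod
      have h2 := Int.eq_zero_of_abs_lt_dvd h1 (by rw [abs_lt]; constructor <;> push_cast <;> omega)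
      omega

/-- Each row has one path of length `s`; it picks up `x` whenever a step lands on `0`, possibly
several times. -/
theorem shiftMatrix_succ_pow_apply {R : Type*} [CommRing R] (m : ℕ) (x : R) (s : ℕ) :
    ∀ i j : Fin (m + 1), (shiftMatrix (m + 1) x ^ s) i j = if j = i + s • 1 then
      ∏ u ∈ Finset.range s, (if i + (u + 1) • 1 = 0 then x else 1) else 0 := by
  induction s with
  | zero => intro i j; simp [Matrix.one_apply, eq_comm]
  | succ s ih =>
    intro i j
    rw [pow_succ, Matrix.mul_apply, Finset.sum_eq_single (i + s • 1)
      (by intro b _ hb; rw [ih, if_neg hb, zero_mul]) (by simp), ih, if_pos rfl,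
      shiftMatrix_succ_apply, Finset.prod_range_succ, succ_nsmul, ← add_assoc]
    split_ifs <;> simp

/-! ### From row profiles to closed walks. -/

/-- The reindexing that turns the row profiles into the states of the transfer matrix. -/
def shearEquiv (m t : ℕ) (X : Type*) : (Fin (m + 1) → Fin t → X) ≃ (Fin (m + 1) → Fin t → X) where
  toFun H j s := H (j - ((s : ℕ) + 1) • 1) s
  invFun p i s := p (i + ((s : ℕ) + 1) • 1) s
  left_inv H := by simp
  right_inv p := by simp

open MvPolynomial in
/-- The weight of a family of row profiles `H`: the coefficient of `∏ⱼ Xⱼᵏ` in its contribution. -/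
theorem coeff_prod_profile {R : Type*} [CommRing R] (k t m : ℕ) (a : Fin (t + 1) → R) (x : R)
    (H : Fin (m + 1) → Fin t → Fin (k + 1)) (E : Fin (m + 1) → Fin (t + 1) → ℕ) :
    coeff (Finsupp.equivFunOnFinite.symm fun _ => k)
      (∏ i, ((∏ s : Fin t, (((E i s.castSucc).choose (E i s.succ) : ℕ) :
          MvPolynomial (Fin (m + 1)) R)) *
        ((∏ s : Fin t, (C (a s.castSucc) * X (i + (s : ℕ) • 1)) ^
            (E i s.castSucc - E i s.succ)) *
          (C (a (Fin.last t)) * X (i + t • 1)) ^ E i (Fin.last t)) *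
        ∏ s : Fin t, C (if i + ((s : ℕ) + 1) • 1 = 0 then x else 1) ^ (H i s : ℕ)))
      = if ∀ j, ∑ s : Fin t, (E (j - (s : ℕ) • 1) s.castSucc - E (j - (s : ℕ) • 1) s.succ)
            + E (j - t • 1) (Fin.last t) = k then
          (∏ i, (∏ s : Fin t, ((E i s.castSucc).choose (E i s.succ) : R)) *
            ((∏ s : Fin t, a s.castSucc ^ (E i s.castSucc - E i s.succ)) *
              a (Fin.last t) ^ E i (Fin.last t))) *
          ∏ i, ∏ s : Fin t, (if i + ((s : ℕ) + 1) • 1 = 0 then x else 1) ^ (H i s : ℕ)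
        else 0 := by
  -- Regroups by column: the particles landing in `j` after `c` steps come from row `j - c`.
  have shift : ∀ (c : Fin (m + 1)) (e : Fin (m + 1) → ℕ),
      ∏ i, (X (i + c) : MvPolynomial (Fin (m + 1)) R) ^ e i = ∏ j, X j ^ e (j - c) := by
    intro c e
    rw [← (Equiv.subRight c).prod_comp]
    simp
  have hX : ∏ i, ((∏ s : Fin t, (X (i + (s : ℕ) • 1) : MvPolynomial (Fin (m + 1)) R) ^
        (E i s.castSucc - E i s.succ)) * X (i + t • 1) ^ E i (Fin.last t))
      = monomial (Finsupp.equivFunOnFinite.symm fun j =>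
          ∑ s : Fin t, (E (j - (s : ℕ) • 1) s.castSucc - E (j - (s : ℕ) • 1) s.succ)
            + E (j - t • 1) (Fin.last t)) 1 := by
    rw [Finset.prod_mul_distrib, shift (t • 1) (fun i => E i (Fin.last t)), Finset.prod_comm,
      monomial_eq, Finsupp.prod_fintype _ _ (by simp)]
    simp only [fun s : Fin t => shift ((s : ℕ) • 1) (fun i => E i s.castSucc - E i s.succ)]
    rw [Finset.prod_comm, ← Finset.prod_mul_distrib]
    simp [pow_add, Finset.prod_pow_eq_pow_sum]
  have hsplit : ∀ (c : R) (q : MvPolynomial (Fin (m + 1)) R) (d e : Fin (m + 1) → ℕ),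
      q = monomial (Finsupp.equivFunOnFinite.symm e) 1 →
      coeff (Finsupp.equivFunOnFinite.symm d) (C c * q) = if ∀ j, e j = d j then c else 0 := by
    rintro c q d e rfl
    rw [coeff_C_mul, coeff_monomial]
    simp only [EmbeddingLike.apply_eq_iff_eq, funext_iff]
    split_ifs <;> simp
  rw [← hsplit _ _ _ _ hX]
  congr 1
  simp only [map_mul, map_prod, map_pow, map_natCast, mul_pow, Finset.prod_mul_distrib]
  ring

/-- The permanent as a sum over families of row profiles; `H i s` counts the entries of the block
row `i` that are displaced by more than `s`. -/
theorem permanent_eq_sum_profile {R : Type*} [CommRing R] (k t m : ℕ) (a : Fin (t + 1) → R)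
    (x : R) :
    (Matrix.kroneckerMap (fun u v : R => u * v)
        (∑ i : Fin (t + 1), a i • shiftMatrix (m + 1) x ^ (i : ℕ)) (onesMatrix R k)).permanent
      = ∑ H : Fin (m + 1) → Fin t → Fin (k + 1),
        let E : Fin (m + 1) → Fin (t + 1) → ℕ := fun i => Fin.cons k fun s => (H i s : ℕ)
        if ∀ j, ∑ s : Fin t, (E (j - (s : ℕ) • 1) s.castSucc - E (j - (s : ℕ) • 1) s.succ)
            + E (j - t • 1) (Fin.last t) = k then
          (∏ i, (k ! : R) * ((∏ s : Fin t, ((E i s.castSucc).choose (E i s.succ) : R)) *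
            ((∏ s : Fin t, a s.castSucc ^ (E i s.castSucc - E i s.succ)) *
              a (Fin.last t) ^ E i (Fin.last t)))) *
          ∏ i, ∏ s : Fin t, (if i + ((s : ℕ) + 1) • 1 = 0 then x else 1) ^ (H i s : ℕ)
        else 0 := by
  have hrow : ∀ i : Fin (m + 1), ∑ j, MvPolynomial.C
      ((∑ s : Fin (t + 1), a s • shiftMatrix (m + 1) x ^ (s : ℕ)) i j) *
        (MvPolynomial.X j : MvPolynomial (Fin (m + 1)) R)
      = ∑ s : Fin (t + 1), (MvPolynomial.C (a s) * MvPolynomial.X (i + (s : ℕ) • 1)) *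
        ∏ u ∈ Finset.range s, MvPolynomial.C (if i + (u + 1) • 1 = 0 then x else 1) := by
    intro i
    simp only [Matrix.sum_apply, Matrix.smul_apply, smul_eq_mul, map_sum, Finset.sum_mul]
    rw [Finset.sum_comm]
    refine Finset.sum_congr rfl fun s _ => ?_
    rw [Finset.sum_eq_single (i + (s : ℕ) • 1)
      (by intro b _ hb; rw [shiftMatrix_succ_pow_apply, if_neg hb]; simp) (by simp),
      shiftMatrix_succ_pow_apply, if_pos rfl, map_mul, map_prod]
    ring
  rw [permanent_kronecker_ones_eq_coeff]
  simp only [hrow]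
  rw [Finset.prod_congr rfl fun i _ => pow_sum_mul_prod k t
    (fun s => MvPolynomial.C (a s) * MvPolynomial.X (i + (s : ℕ) • 1))
    (fun u => MvPolynomial.C (if i + (u + 1) • 1 = 0 then x else 1)) k le_rfl,
    Fintype.prod_sum, MvPolynomial.coeff_sum, Finset.mul_sum]
  refine Finset.sum_congr rfl fun H _ => ?_
  have := coeff_prod_profile k t m a x H fun i => Fin.cons k fun s => (H i s : ℕ)
  simp only [Fin.val_castSucc, Fin.val_last]
  rw [this]
  simp only [mul_ite, mul_zero]
  refine if_congr Iff.rfl ?_ rfl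
  rw [Finset.prod_mul_distrib (f := fun _ => (k ! : R)), Finset.prod_const, Finset.card_univ,
    mul_assoc]

theorem theorem18 {R : Type*} [CommRing R] (k t n : ℕ) (hk : 1 ≤ k) (hn : 1 ≤ n)
    (a : Fin (t + 1) → R) (x : R) :
    (Matrix.kroneckerMap (fun u v : R => u * v)
        (∑ i : Fin (t + 1), a i • shiftMatrix n x ^ (i : ℕ)) (onesMatrix R k)).permanent
      = ∑ r ∈ Finset.range (k * t + 1), (PiMatrix k r t a ^ n).trace * x ^ r := by
  obtain ⟨m, rfl⟩ := Nat.exists_eq_add_of_le' hn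
  rw [permanent_eq_sum_profile, sum_trace_PiMatrix_pow, sum_pow_diag_mul]
  conv_rhs => rw [← (shearEquiv m t (Fin (k + 1))).sum_comp]
  refine Finset.sum_congr rfl fun H _ => ?_
  set E : Fin (m + 1) → Fin (t + 1) → ℕ := fun i => Fin.cons k fun s => (H i s : ℕ) with hE
  -- The leading `k` is the batch launched at `j` itself, of age `0`.
  have hcons : ∀ (j : Fin (m + 1)) (s : Fin (t + 1)),
      (Fin.cons k fun u => (shearEquiv m t (Fin (k + 1)) H j u : ℕ) : Fin (t + 1) → ℕ) s
        = E (j - (s : ℕ) • 1) s := by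
    intro j s
    refine Fin.cases ?_ (fun s => ?_) s <;> simp [hE, shearEquiv]
  -- Moving to column `j + 1` raises the age by one and keeps the row `j - s`, which makes the
  -- landing condition local.
  have hnext : ∀ (j : Fin (m + 1)) (s : Fin t),
      (shearEquiv m t (Fin (k + 1)) H (j + 1) s : ℕ) = E (j - (s : ℕ) • 1) s.succ := by
    intro j s
    have : j + 1 - ((s : ℕ) + 1) • (1 : Fin (m + 1)) = j - (s : ℕ) • 1 := by
      rw [succ_nsmul, add_sub_add_right_eq_sub]
    simp only [hE, shearEquiv, Equiv.coe_fn_mk, Fin.cons_succ, this]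
  have hW : ∀ j, transferMatrix k t a (shearEquiv m t (Fin (k + 1)) H j)
        (shearEquiv m t (Fin (k + 1)) H (j + 1))
      = if ∑ s : Fin t, (E (j - (s : ℕ) • 1) s.castSucc - E (j - (s : ℕ) • 1) s.succ)
            + E (j - t • 1) (Fin.last t) = k then
          (k ! : R) * ((∏ s : Fin t, ((E (j - (s : ℕ) • 1) s.castSucc).choose
            (E (j - (s : ℕ) • 1) s.succ) : R)) *
            ((∏ s : Fin t, a s.castSucc ^
              (E (j - (s : ℕ) • 1) s.castSucc - E (j - (s : ℕ) • 1) s.succ)) *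
              a (Fin.last t) ^ E (j - t • 1) (Fin.last t)))
        else 0 := by
    intro j
    simp only [transferMatrix, Matrix.of_apply, hcons, hnext, Fin.val_castSucc, Fin.val_last]
  have hreindex : ∀ (c : Fin (m + 1)) (F : Fin (m + 1) → R), ∏ j, F (j - c) = ∏ i, F i :=
    fun c F => (Equiv.subRight c).prod_comp F
  have hx : ∏ i, ∏ s : Fin t, (if i + ((s : ℕ) + 1) • 1 = 0 then x else 1) ^ (H i s : ℕ)
      = x ^ ∑ s, (shearEquiv m t (Fin (k + 1)) H 0 s : ℕ) := by
    rw [Finset.prod_comm, ← Finset.prod_pow_eq_pow_sum]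
    refine Finset.prod_congr rfl fun s _ => ?_
    -- For fixed `s`, only the row `-(s + 1)` meets the seam at its step `s + 1`.
    rw [Finset.prod_eq_single (0 - ((s : ℕ) + 1) • 1)]
    · simp [shearEquiv]
    · intro i _ hi
      rw [if_neg (fun h => hi (by rw [zero_sub]; exact eq_neg_of_add_eq_zero_left h)), one_pow]
    · simp
  simp only [hW]
  rw [Finset.prod_ite_zero]
  simp only [Finset.mem_univ, true_implies]
  rw [ite_mul, zero_mul, hx]
  refine if_congr Iff.rfl ?_ rfl
  congr 1
  -- Both sides now hold the same factors, translated along the cycle by an amount depending on `s`;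
  -- each full product over the cycle is invariant.
  simp only [Finset.prod_mul_distrib]
  congr 2
  · rw [Finset.prod_comm, Finset.prod_comm (s := Finset.univ (α := Fin (m + 1)))]
    exact Finset.prod_congr rfl fun s _ => (hreindex ((s : ℕ) • 1)
      fun i => ((E i s.castSucc).choose (E i s.succ) : R)).symm
  · congr 1
    · rw [Finset.prod_comm, Finset.prod_comm (s := Finset.univ (α := Fin (m + 1)))]
      exact Finset.prod_congr rfl fun s _ => (hreindex ((s : ℕ) • 1)
        fun i => a s.castSucc ^ (E i s.castSucc - E i s.succ)).symm
    · exact (hreindex (t • 1) fun i => a (Fin.last t) ^ E i (Fin.last t)).symm
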